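/- Let $X$ be a finite set of items. A valuation on $X$ is a function $v:2^X\to\mathbb{R}_{\ge 0}$ with $v(\emptyset)=0$ and $v(A)\le v(B)$ whenever $A\subseteq B$. For a price vector $p\in\mathbb{R}^X$, the demand set $D(v\mid p)$ is the set of all $S\subseteq X$ that maximize the surplus $v(S)-\sum_{i\in S}p_i$ over all subsets of $X$. A valuation $v$ satisfies the gross substitutes property if for every item $i\in X$ and all price vectors $p,q\in\mathbb{R}^X$ with $q\ge p$ coordinatewise and $q_i=p_i$: whenever $i\in A$ for some $A\in D(v\mid p)$, there is $A'\in D(v\mid q)$ with $i\in A'$. The OR of two valuations $u,w$ on $X$ is defined by $(u\vee w)(S)=\max_{T\subseteq S}\bigl(u(T)+w(S\setminus T)\bigr)$ for $S\subseteq X$. **Theorem.** If $u$ and $w$ are valuations on $X$ that satisfy the gross substitutes property, then $u\vee w$ is a valuation on $X$ that satisfies the gross substitutes property. -/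

import Mathlib

namespace Auction

/-- A valuation on a set `X` of items: a function from bundles (subsets of `X`) to the non-negative
reals that is normalized and monotone (free disposal). -/
structure IsValuation {X : Type*} (v : Finset X → ℝ) : Prop where
  nonneg : ∀ A : Finset X, 0 ≤ v A
  empty : v ∅ = 0
  mono : ∀ A B : Finset X, A ⊆ B → v A ≤ v B

/-- The surplus `v(S | p) = v(S) - ∑ i ∈ S, p i` of a bundle at a real price vector. -/
def surplus {X : Type*} (v : Finset X → ℝ) (p : X → ℝ) (S : Finset X) : ℝ :=
  v S - ∑ i ∈ S, p i

/-- The demand set `D(v | p)`: the bundles that maximize the surplus. -/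
def demand {X : Type*} (v : Finset X → ℝ) (p : X → ℝ) : Set (Finset X) :=
  {S | ∀ T : Finset X, surplus v p T ≤ surplus v p S}

/-- The gross substitutes property: if prices rise from `p` to `q`, the price of the item `i` is
unchanged, and `i` lies in some preferred set at `p`, then `i` lies in some preferred set at `q`. -/
def GrossSubstitutes {X : Type*} (v : Finset X → ℝ) : Prop :=
  ∀ (i : X) (p q : X → ℝ), p ≤ q → p i = q i →
    ∀ A ∈ demand v p, i ∈ A → ∃ A' ∈ demand v q, i ∈ A'

/-- The OR of two valuations: `(u ∨ w)(S) = max_{T ⊆ S} (u(T) + w(S - T))`. -/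
noncomputable def orVal {X : Type*} [DecidableEq X] (u w : Finset X → ℝ) (S : Finset X) : ℝ :=
  S.powerset.sup' ⟨∅, Finset.empty_mem_powerset S⟩ fun T => u T + w (S \ T)

end Auction

/-! A valuation is gross substitutes iff its indirect utility `V` is submodular in prices
(`GrossSubstitutes.submodularUtility`, `SubmodularUtility.grossSubstitutes`). For the OR,
`V_{u∨w}(q)` is the infimum over `r ≥ q` of `V_u(r) + V_w(r) + ∑ (r - q)`. The bound `≤` is direct;
near-equality comes from a Kelso–Crawford auction opened at `q`, whose final prices nearly clear the
market. Partial minimization over `r ≥ q` preserves submodularity. -/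

namespace Auction

section Utility

variable {X : Type*} [Fintype X]

/-- The maximal surplus a bidder with valuation `v` can obtain at prices `p`. -/
noncomputable def indirectUtility (v : Finset X → ℝ) (p : X → ℝ) : ℝ :=
  Finset.univ.sup' Finset.univ_nonempty (surplus v p)

theorem surplus_le_indirectUtility (v : Finset X → ℝ) (p : X → ℝ) (S : Finset X) :
    surplus v p S ≤ indirectUtility v p :=
  Finset.le_sup' (surplus v p) (Finset.mem_univ S)

theorem indirectUtility_le {v : Finset X → ℝ} {p : X → ℝ} {c : ℝ}
    (h : ∀ S, surplus v p S ≤ c) : indirectUtility v p ≤ c :=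
  Finset.sup'_le _ _ fun S _ => h S

theorem mem_demand_iff {v : Finset X → ℝ} {p : X → ℝ} {S : Finset X} :
    S ∈ demand v p ↔ indirectUtility v p ≤ surplus v p S :=
  ⟨fun h => indirectUtility_le h, fun h T => (surplus_le_indirectUtility v p T).trans h⟩

theorem surplus_eq_of_mem_demand {v : Finset X → ℝ} {p : X → ℝ} {S : Finset X}
    (h : S ∈ demand v p) : surplus v p S = indirectUtility v p :=
  le_antisymm (surplus_le_indirectUtility v p S) (mem_demand_iff.1 h)

theorem demand_nonempty (v : Finset X → ℝ) (p : X → ℝ) : (demand v p).Nonempty := by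
  obtain ⟨S, -, hS⟩ := Finset.exists_mem_eq_sup' Finset.univ_nonempty (surplus v p)
  exact ⟨S, mem_demand_iff.2 hS.le⟩

theorem indirectUtility_antitone (v : Finset X → ℝ) : Antitone (indirectUtility v) := by
  intro p q h
  refine indirectUtility_le fun S => le_trans ?_ (surplus_le_indirectUtility v p S)
  exact sub_le_sub_left (Finset.sum_le_sum fun i _ => h i) _

/-- The indirect utility function is submodular on the lattice of price vectors. -/
def SubmodularUtility (v : Finset X → ℝ) : Prop :=
  ∀ a b : X → ℝ, indirectUtility v (a ⊓ b) + indirectUtility v (a ⊔ b) ≤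
    indirectUtility v a + indirectUtility v b

end Utility

variable {X : Type*} [DecidableEq X]

theorem surplus_add_single (v : Finset X → ℝ) (p : X → ℝ) (i : X) (t : ℝ) (S : Finset X) :
    surplus v (p + Pi.single i t) S = surplus v p S - if i ∈ S then t else 0 := by
  simp only [surplus, Pi.add_apply, Finset.sum_add_distrib, Pi.single_apply,
    Finset.sum_ite_eq']
  ring

theorem surplus_sub_const (v : Finset X → ℝ) (p : X → ℝ) (K S : Finset X) :
    surplus v (fun i => if i ∈ K then p i - 1 else p i) S = surplus v p S + (S ∩ K).card := by
  have : ∀ i, (if i ∈ K then p i - 1 else p i) = p i - if i ∈ K then 1 else 0 := by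
    intro i
    split_ifs <;> simp
  simp only [surplus, this, Finset.sum_sub_distrib, Finset.sum_ite_mem, Finset.sum_const,
    nsmul_eq_mul, mul_one]
  ring

/-- The prices faced in an ascending auction with increment `ε` by a bidder holding `S`, when the
opening prices are `q` and the price of `j` was raised `k j` times. -/
noncomputable def auctionPrice (q : X → ℝ) (ε : ℝ) (k : X → ℕ) (S : Finset X) (j : X) : ℝ :=
  q j + ε * (k j + if j ∈ S then 0 else 1)

/-- A state of the Kelso–Crawford ascending auction with two bidders. -/
structure AuctionState (u w : Finset X → ℝ) (q : X → ℝ) (ε : ℝ) (k : X → ℕ)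
    (S T : Finset X) : Prop where
  disjoint : Disjoint S T
  unsold : ∀ j, j ∉ S → j ∉ T → k j = 0
  left : ∃ A ∈ demand u (auctionPrice q ε k S), S ⊆ A
  right : ∃ A ∈ demand w (auctionPrice q ε k T), T ⊆ A

theorem AuctionState.symm {u w : Finset X → ℝ} {q : X → ℝ} {ε : ℝ} {k : X → ℕ}
    {S T : Finset X} (h : AuctionState u w q ε k S T) : AuctionState w u q ε k T S :=
  ⟨h.disjoint.symm, fun j hT hS => h.unsold j hS hT, h.right, h.left⟩

theorem le_orVal (u w : Finset X → ℝ) {S T : Finset X} (h : T ⊆ S) :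
    u T + w (S \ T) ≤ orVal u w S :=
  Finset.le_sup' (fun T => u T + w (S \ T)) (Finset.mem_powerset.2 h)

theorem exists_orVal_eq (u w : Finset X → ℝ) (S : Finset X) :
    ∃ T ⊆ S, orVal u w S = u T + w (S \ T) := by
  obtain ⟨T, hT, h⟩ := Finset.exists_mem_eq_sup' ⟨∅, Finset.empty_mem_powerset S⟩
    fun T => u T + w (S \ T)
  exact ⟨T, Finset.mem_powerset.1 hT, h⟩

theorem IsValuation.orVal {u w : Finset X → ℝ} (hu : IsValuation u) (hw : IsValuation w) :
    IsValuation (orVal u w) where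
  nonneg A := (add_nonneg (hu.nonneg _) (hw.nonneg _)).trans (le_orVal u w (Finset.empty_subset A))
  empty := by
    obtain ⟨T, hT, h⟩ := exists_orVal_eq u w ∅
    rw [h, Finset.subset_empty.1 hT, Finset.empty_sdiff, hu.empty, hw.empty, add_zero]
  mono A B hAB := by
    obtain ⟨T, hT, h⟩ := exists_orVal_eq u w A
    rw [h]
    exact (add_le_add_right (hw.mono _ _ (Finset.sdiff_subset_sdiff hAB subset_rfl)) _).trans
      (le_orVal u w (hT.trans hAB))

variable [Fintype X]

/-! ### Gross substitutes and submodular indirect utility. -/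

/-- The drop `s` of utility at `p` is, if positive, the largest rise of the price of `i` at which
`i` is still demanded. Gross substitutes keeps `i` demanded at `q` raised by `s`, so the drop at `q`
is at least `s`. -/
theorem GrossSubstitutes.single_decreasing_differences {v : Finset X → ℝ}
    (hv : GrossSubstitutes v) {p q : X → ℝ} (hpq : p ≤ q) {i : X} (hi : p i = q i) {t : ℝ}
    (ht : 0 ≤ t) :
    indirectUtility v p + indirectUtility v (q + Pi.single i t) ≤
      indirectUtility v (p + Pi.single i t) + indirectUtility v q := by
  have hmono : ∀ r : X → ℝ, ∀ s : ℝ, 0 ≤ s →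
      indirectUtility v (r + Pi.single i s) ≤ indirectUtility v r := by
    intro r s hs
    have h0 : (0 : X → ℝ) ≤ Pi.single i s := Pi.single_nonneg.2 hs
    exact indirectUtility_antitone v (le_add_of_nonneg_right h0)
  obtain ⟨s, hs⟩ : ∃ s, indirectUtility v p = indirectUtility v (p + Pi.single i t) + s :=
    ⟨indirectUtility v p - indirectUtility v (p + Pi.single i t), by ring⟩
  rcases le_or_gt s 0 with h0 | h0
  · linarith [hmono q t ht]
  obtain ⟨A, hA⟩ := demand_nonempty v p
  have hAs := surplus_eq_of_mem_demand hA
  have hAt := surplus_le_indirectUtility v (p + Pi.single i t) A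
  rw [surplus_add_single] at hAt
  have hiA : i ∈ A := by
    by_contra h
    rw [if_neg h] at hAt
    linarith
  rw [if_pos hiA] at hAt
  have hA' : A ∈ demand v (p + Pi.single i s) := by
    intro B
    rw [surplus_add_single, surplus_add_single, if_pos hiA]
    have h1 := surplus_le_indirectUtility v p B
    have h2 := surplus_le_indirectUtility v (p + Pi.single i t) B
    rw [surplus_add_single] at h2
    split_ifs at h2 ⊢ <;> linarith
  have hpq' : p + Pi.single i s ≤ q + Pi.single i s := add_le_add_left hpq _
  obtain ⟨B, hB, hiB⟩ := hv i _ _ hpq' (by simp [hi]) A hA' hiA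
  have h1 := surplus_eq_of_mem_demand hB
  rw [surplus_add_single, if_pos hiB] at h1
  have h2 := surplus_le_indirectUtility v q B
  have h3 : indirectUtility v (q + Pi.single i t) ≤ indirectUtility v (q + Pi.single i s) := by
    have hst : (Pi.single i s : X → ℝ) ≤ Pi.single i t := Pi.single_le_single.2 (by linarith)
    exact indirectUtility_antitone v (add_le_add_right hst q)
  linarith

theorem GrossSubstitutes.decreasing_differences {v : Finset X → ℝ}
    (hv : GrossSubstitutes v) {p q d : X → ℝ} (hpq : p ≤ q) (hd : 0 ≤ d) (K : Finset X)
    (hK : ∀ i ∈ K, p i = q i) :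
    indirectUtility v p + indirectUtility v (q + ∑ i ∈ K, (Pi.single i (d i) : X → ℝ)) ≤
      indirectUtility v (p + ∑ i ∈ K, (Pi.single i (d i) : X → ℝ)) + indirectUtility v q := by
  induction K using Finset.induction_on with
  | empty => simp
  | insert i K hiK ih =>
    have h1 := ih fun j hj => hK j (Finset.mem_insert_of_mem hj)
    have h2 := hv.single_decreasing_differences
      (add_le_add_left hpq (∑ j ∈ K, (Pi.single j (d j) : X → ℝ))) (i := i)
      (by simp [hK i (Finset.mem_insert_self i K)]) (hd i)
    rw [Finset.sum_insert hiK, add_comm (Pi.single i (d i) : X → ℝ), ← add_assoc, ← add_assoc]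
    linarith

theorem GrossSubstitutes.submodularUtility {v : Finset X → ℝ} (hv : GrossSubstitutes v) :
    SubmodularUtility v := by
  intro a b
  -- On the items with `b i ≤ a i` the prices `a ⊓ b` and `b` agree; elsewhere the increment `a - a
  -- ⊓ b` vanishes.
  have key := hv.decreasing_differences (p := a ⊓ b) (q := b) (d := a - a ⊓ b) inf_le_right
    (sub_nonneg.2 inf_le_left) (Finset.univ.filter fun i => b i ≤ a i)
    (fun i hi => inf_eq_right.2 (Finset.mem_filter.1 hi).2)
  have hsum : ∑ i ∈ Finset.univ.filter (fun i => b i ≤ a i),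
      (Pi.single i ((a - a ⊓ b) i) : X → ℝ) = a - a ⊓ b := by
    rw [Finset.sum_filter_of_ne, Finset.univ_sum_single]
    intro i _ hi
    by_contra h
    exact hi (by simp [inf_eq_left.2 (not_le.1 h).le])
  rw [hsum, add_sub_cancel] at key
  have hsup : b + (a - a ⊓ b) = a ⊔ b := by
    have := inf_add_sup a b
    rw [← add_sub_assoc, add_comm b a, ← this, add_sub_cancel_left]
  rwa [hsup] at key

/-- Raising some prices keeps jointly demanded all the items of a demanded bundle whose prices
did not change. -/
theorem SubmodularUtility.exists_superset_mem_demand {v : Finset X → ℝ}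
    (hv : SubmodularUtility v) {p q : X → ℝ} (hpq : p ≤ q) {A K : Finset X}
    (hA : A ∈ demand v p) (hKA : K ⊆ A) (hK : ∀ i ∈ K, p i = q i) :
    ∃ B ∈ demand v q, K ⊆ B := by
  -- A unit discount on `K` gains at least `K.card` at `p`, hence by submodularity at `q`. A bundle
  -- demanded at the discounted `q` must then contain all of `K`.
  have hsub := hv p (fun i => if i ∈ K then q i - 1 else q i)
  have hinf : p ⊓ (fun i => if i ∈ K then q i - 1 else q i) =
      fun i => if i ∈ K then p i - 1 else p i := by
    ext i
    by_cases h : i ∈ K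
    · simp [h, hK i h]
    · simpa [h] using hpq i
  have hsup : p ⊔ (fun i => if i ∈ K then q i - 1 else q i) = q := by
    ext i
    by_cases h : i ∈ K
    · simp [h, hK i h]
    · simpa [h] using hpq i
  rw [hinf, hsup] at hsub
  have h1 := surplus_le_indirectUtility v (fun i => if i ∈ K then p i - 1 else p i) A
  rw [surplus_sub_const, Finset.inter_eq_right.2 hKA, surplus_eq_of_mem_demand hA] at h1
  obtain ⟨B, hB⟩ := demand_nonempty v fun i => if i ∈ K then q i - 1 else q i
  have h2 := surplus_eq_of_mem_demand hB
  rw [surplus_sub_const] at h2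
  have h3 := surplus_le_indirectUtility v q B
  have h4 : ((B ∩ K).card : ℝ) ≤ K.card :=
    Nat.cast_le.2 (Finset.card_le_card Finset.inter_subset_right)
  refine ⟨B, mem_demand_iff.2 (by linarith), ?_⟩
  have h5 : K.card ≤ (B ∩ K).card := by
    have : (K.card : ℝ) ≤ (B ∩ K).card := by linarith
    exact_mod_cast this
  exact Finset.inter_eq_right.1 (Finset.eq_of_subset_of_card_le Finset.inter_subset_right h5)

theorem SubmodularUtility.grossSubstitutes {v : Finset X → ℝ} (hv : SubmodularUtility v) :
    GrossSubstitutes v := by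
  intro i p q hpq hi A hA hiA
  obtain ⟨B, hB, hKB⟩ := hv.exists_superset_mem_demand hpq hA
    (Finset.singleton_subset_iff.2 hiA) (by simpa using hi)
  exact ⟨B, hB, Finset.singleton_subset_iff.1 hKB⟩

/-! ### The ascending auction. -/

/-- The first bidder takes all of a demanded `A ⊇ S`. The surcharge `ε` on `A \ S` becomes a price
raise, so this bidder's prices are unchanged. The other bidder keeps `T \ A`, where prices stay
fixed while the rest weakly rise. -/
theorem AuctionState.step {u w : Finset X → ℝ} (hw : SubmodularUtility w) {q : X → ℝ} {ε : ℝ}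
    (hε : 0 ≤ ε) {k : X → ℕ} {S T : Finset X} (h : AuctionState u w q ε k S T)
    (hS : S ∉ demand u (auctionPrice q ε k S)) :
    ∃ k' S' T', AuctionState u w q ε k' S' T' ∧ ∑ j, k j < ∑ j, k' j := by
  obtain ⟨A, hA, hSA⟩ := h.left
  obtain ⟨B, hB, hTB⟩ := h.right
  have hne : ∃ j ∈ A, j ∉ S := by
    by_contra! hall
    exact hS (hSA.antisymm hall ▸ hA)
  let k' : X → ℕ := fun j => k j + if j ∈ A \ S then 1 else 0
  have hST : ∀ j, j ∈ T → j ∉ S := fun j hT hS => Finset.disjoint_left.1 h.disjoint hS hT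
  refine ⟨k', A, T \ A, ⟨Finset.disjoint_sdiff, ?_, ⟨A, ?_, subset_rfl⟩, ?_⟩, ?_⟩
  · intro j hjA hjT
    have hjS : j ∉ S := fun hj => hjA (hSA hj)
    have hjT' : j ∉ T := fun hj => hjT (Finset.mem_sdiff.2 ⟨hj, hjA⟩)
    simp [k', hjA, h.unsold j hjS hjT']
  · have : auctionPrice q ε k' A = auctionPrice q ε k S := by
      ext j
      by_cases hjS : j ∈ S
      · simp [auctionPrice, k', hjS, hSA hjS]
      · by_cases hjA : j ∈ A <;> simp [auctionPrice, k', hjS, hjA]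
    rwa [this]
  · refine hw.exists_superset_mem_demand ?_ hB (Finset.sdiff_subset.trans hTB) ?_
    · intro j
      refine add_le_add_right (mul_le_mul_of_nonneg_left ?_ hε) _
      by_cases hjT : j ∈ T
      · by_cases hjA : j ∈ A
        · have h0 : (k j : ℝ) ≤ k j + 1 + 1 := by linarith
          simpa [k', hjT, hjA, hST j hjT] using h0
        · simp [k', hjT, hjA]
      · simp [k', hjT, apply_ite]
    · intro j hj
      obtain ⟨hjT, hjA⟩ := Finset.mem_sdiff.1 hj
      simp [auctionPrice, k', hjT, hjA]
  · obtain ⟨j, hjA, hjS⟩ := hne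
    refine Finset.sum_lt_sum (fun i _ => Nat.le_add_right _ _) ⟨j, Finset.mem_univ j, ?_⟩
    simp [k', hjA, hjS]

theorem IsValuation.price_le_of_mem_demand {v : Finset X → ℝ} (hv : IsValuation v) {p : X → ℝ}
    {A : Finset X} (hA : A ∈ demand v p) {j : X} (hj : j ∈ A) : p j ≤ v Finset.univ := by
  have h := hA (A.erase j)
  simp only [surplus, ← Finset.add_sum_erase A p hj] at h
  linarith [hv.nonneg (A.erase j), hv.mono A Finset.univ (Finset.subset_univ A)]

theorem AuctionState.price_le {u w : Finset X → ℝ} (hu : IsValuation u) {q : X → ℝ} {ε : ℝ}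
    {k : X → ℕ} {S T : Finset X} (h : AuctionState u w q ε k S T) {j : X} (hj : j ∈ S) :
    q j + ε * k j ≤ u Finset.univ := by
  obtain ⟨A, hA, hSA⟩ := h.left
  simpa [auctionPrice, hj] using hu.price_le_of_mem_demand hA (hSA hj)

theorem AuctionState.count_le {u w : Finset X → ℝ} (hu : IsValuation u) (hw : IsValuation w)
    {q : X → ℝ} {ε : ℝ} (hε : 0 < ε) {k : X → ℕ} {S T : Finset X}
    (h : AuctionState u w q ε k S T) (j : X) :
    k j ≤ ⌈(u Finset.univ + w Finset.univ - q j) / ε⌉₊ := by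
  have hu0 := hu.nonneg Finset.univ
  have hw0 := hw.nonneg Finset.univ
  by_cases hS : j ∈ S
  · refine Nat.cast_le.1 (le_trans ((le_div_iff₀ hε).2 ?_) (Nat.le_ceil (R := ℝ) _))
    linarith [h.price_le hu hS]
  by_cases hT : j ∈ T
  · refine Nat.cast_le.1 (le_trans ((le_div_iff₀ hε).2 ?_) (Nat.le_ceil (R := ℝ) _))
    linarith [h.symm.price_le hw hT]
  simp [h.unsold j hS hT]

/-- The ascending auction reaches an approximate Walrasian equilibrium. -/
theorem exists_terminal_auctionState {u w : Finset X → ℝ} (hu : IsValuation u)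
    (hw : IsValuation w) (hsu : SubmodularUtility u) (hsw : SubmodularUtility w) (q : X → ℝ)
    {ε : ℝ} (hε : 0 < ε) :
    ∃ k S T, AuctionState u w q ε k S T ∧ S ∈ demand u (auctionPrice q ε k S) ∧
      T ∈ demand w (auctionPrice q ε k T) := by
  -- The total number of raises is bounded, and a state maximizing it admits no further step.
  let N : Set ℕ := {n | ∃ k S T, AuctionState u w q ε k S T ∧ ∑ j, k j = n}
  have hne : N.Nonempty := by
    obtain ⟨A, hA⟩ := demand_nonempty u (auctionPrice q ε 0 ∅)
    obtain ⟨B, hB⟩ := demand_nonempty w (auctionPrice q ε 0 ∅)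
    exact ⟨_, 0, ∅, ∅, ⟨Finset.disjoint_empty_left _, fun _ _ _ => rfl,
      ⟨A, hA, Finset.empty_subset A⟩, ⟨B, hB, Finset.empty_subset B⟩⟩, rfl⟩
  have hbdd : BddAbove N := by
    refine ⟨∑ j, ⌈(u Finset.univ + w Finset.univ - q j) / ε⌉₊, ?_⟩
    rintro _ ⟨k, S, T, h, rfl⟩
    exact Finset.sum_le_sum fun j _ => h.count_le hu hw hε j
  obtain ⟨k, S, T, h, hk⟩ := Nat.sSup_mem hne hbdd
  refine ⟨k, S, T, h, ?_, ?_⟩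
  · by_contra hS
    obtain ⟨k', S', T', h', hlt⟩ := h.step hsw hε.le hS
    exact (hlt.trans_le (le_csSup hbdd ⟨k', S', T', h', rfl⟩)).ne hk
  · by_contra hT
    obtain ⟨k', T', S', h', hlt⟩ := h.symm.step hsu hε.le hT
    exact (hlt.trans_le (le_csSup hbdd ⟨k', S', T', h'.symm, rfl⟩)).ne hk

/-! ### Price duality for the OR. -/

theorem indirectUtility_le_of_mem_demand_auctionPrice {v : Finset X → ℝ} {q : X → ℝ} {ε : ℝ}
    (hε : 0 ≤ ε) {k : X → ℕ} {S : Finset X} (hS : S ∈ demand v (auctionPrice q ε k S)) :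
    indirectUtility v (fun j => q j + ε * k j) ≤
      v S - ∑ j ∈ S, (q j + ε * k j) + Fintype.card X * ε := by
  have hS' : surplus v (auctionPrice q ε k S) S = v S - ∑ j ∈ S, (q j + ε * k j) := by
    refine congrArg (v S - ·) (Finset.sum_congr rfl fun j hj => ?_)
    simp [auctionPrice, hj]
  refine indirectUtility_le fun A => ?_
  have h := hS A
  rw [hS'] at h
  have h2 : ∑ j ∈ A, auctionPrice q ε k S j ≤ ∑ j ∈ A, (q j + ε * k j) + A.card * ε := by
    rw [← nsmul_eq_mul, ← Finset.sum_const, ← Finset.sum_add_distrib]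
    refine Finset.sum_le_sum fun j _ => ?_
    unfold auctionPrice
    split_ifs <;> linarith
  have h3 : (A.card : ℝ) * ε ≤ Fintype.card X * ε :=
    mul_le_mul_of_nonneg_right (Nat.cast_le.2 (Finset.card_le_univ A)) hε
  simp only [surplus] at h ⊢
  linarith

theorem indirectUtility_orVal_le (u w : Finset X → ℝ) {q r : X → ℝ} (h : q ≤ r) :
    indirectUtility (orVal u w) q ≤
      indirectUtility u r + indirectUtility w r + ∑ j, (r j - q j) := by
  refine indirectUtility_le fun S => ?_
  obtain ⟨T, hT, hST⟩ := exists_orVal_eq u w S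
  have h1 := surplus_le_indirectUtility u r T
  have h2 := surplus_le_indirectUtility w r (S \ T)
  have h3 : ∑ j ∈ S, (r j - q j) ≤ ∑ j, (r j - q j) :=
    Finset.sum_le_sum_of_subset_of_nonneg (Finset.subset_univ S) fun j _ _ => sub_nonneg.2 (h j)
  have h4 := Finset.sum_sdiff hT (f := r)
  rw [Finset.sum_sub_distrib] at h3
  simp only [surplus] at h1 h2 ⊢
  linarith

theorem exists_le_indirectUtility_orVal {u w : Finset X → ℝ} (hu : IsValuation u)
    (hw : IsValuation w) (hsu : SubmodularUtility u) (hsw : SubmodularUtility w) (q : X → ℝ)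
    {δ : ℝ} (hδ : 0 < δ) :
    ∃ r, q ≤ r ∧ indirectUtility u r + indirectUtility w r + ∑ j, (r j - q j) ≤
      indirectUtility (orVal u w) q + δ := by
  have hn : (0 : ℝ) < 2 * (Fintype.card X + 1) := by positivity
  -- Each bidder's error is `Fintype.card X * ε`; the `+ 1` covers empty `X`.
  obtain ⟨ε, hε, hεδ⟩ : ∃ ε : ℝ, 0 < ε ∧ 2 * (Fintype.card X + 1) * ε = δ :=
    ⟨δ / (2 * (Fintype.card X + 1)), div_pos hδ hn, mul_div_cancel₀ _ hn.ne'⟩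
  obtain ⟨k, S, T, h, hS, hT⟩ := exists_terminal_auctionState hu hw hsu hsw q hε
  refine ⟨fun j => q j + ε * k j,
    fun j => le_add_of_nonneg_right (mul_nonneg hε.le (Nat.cast_nonneg _)), ?_⟩
  have h1 := indirectUtility_le_of_mem_demand_auctionPrice hε.le hS
  have h2 := indirectUtility_le_of_mem_demand_auctionPrice hε.le hT
  have h3 := surplus_le_indirectUtility (Auction.orVal u w) q (S ∪ T)
  have h4 := le_orVal u w (Finset.subset_union_left (s₁ := S) (s₂ := T))
  rw [Finset.union_sdiff_cancel_left h.disjoint] at h4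
  -- Unsold items still have their opening prices.
  have h5 : ∑ j, ((q j + ε * k j) - q j) = ∑ j ∈ S ∪ T, ((q j + ε * k j) - q j) := by
    symm
    refine Finset.sum_subset (Finset.subset_univ _) fun j _ hj => ?_
    rw [Finset.mem_union, not_or] at hj
    simp [h.unsold j hj.1 hj.2]
  rw [h5, Finset.sum_sub_distrib, Finset.sum_union h.disjoint]
  simp only [surplus] at h3
  linarith

/-- Near-minimizers `r ≥ a` and `s ≥ b` give `r ⊓ s ≥ a ⊓ b` and `r ⊔ s ≥ a ⊔ b`; the linear term is
modular. -/
theorem SubmodularUtility.orVal {u w : Finset X → ℝ} (hu : IsValuation u)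
    (hw : IsValuation w) (hsu : SubmodularUtility u) (hsw : SubmodularUtility w) :
    SubmodularUtility (orVal u w) := by
  intro a b
  refine le_of_forall_pos_le_add fun δ hδ => ?_
  obtain ⟨r, har, hr⟩ := exists_le_indirectUtility_orVal hu hw hsu hsw a (half_pos hδ)
  obtain ⟨s, hbs, hs⟩ := exists_le_indirectUtility_orVal hu hw hsu hsw b (half_pos hδ)
  have h1 := indirectUtility_orVal_le u w (inf_le_inf har hbs)
  have h2 := indirectUtility_orVal_le u w (sup_le_sup har hbs)
  have h3 : ∑ j, ((r ⊓ s) j - (a ⊓ b) j) + ∑ j, ((r ⊔ s) j - (a ⊔ b) j) =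
      ∑ j, (r j - a j) + ∑ j, (s j - b j) := by
    rw [← Finset.sum_add_distrib, ← Finset.sum_add_distrib]
    refine Finset.sum_congr rfl fun j _ => ?_
    have hrs : (r ⊓ s) j + (r ⊔ s) j = r j + s j := inf_add_sup (r j) (s j)
    have hab : (a ⊓ b) j + (a ⊔ b) j = a j + b j := inf_add_sup (a j) (b j)
    linarith
  linarith [hsu r s, hsw r s]

end Auction

theorem mainTheorem7 {X : Type*} [Fintype X] [DecidableEq X] (u w : Finset X → ℝ)
    (hu : Auction.IsValuation u) (hw : Auction.IsValuation w)
    (hgu : Auction.GrossSubstitutes u) (hgw : Auction.GrossSubstitutes w) :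
    Auction.IsValuation (Auction.orVal u w) ∧
      Auction.GrossSubstitutes (Auction.orVal u w) :=
  ⟨hu.orVal hw, (Auction.SubmodularUtility.orVal hu hw hgu.submodularUtility
    hgw.submodularUtility).grossSubstitutes⟩
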